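/- A path is a finite sequence of north and east unit steps on the square grid starting at $(0,0)$. For a path $v$, let $\mathrm{Tam}(v)$ be the poset on the set of paths $u$ that are weakly above $v$ and have the same endpoint as $v$, whose order is the reflexive and transitive closure of the following relation. For an integer point $p$ of such a path $u$, let $\mathrm{horiz}_v(p)$ be the maximum number of east steps that can be added to the right of $p$ without crossing $v$. Suppose that $p$ is preceded by an east step $E$ and followed by a north step in $u$, let $p'$ be the first integer point of $u$ strictly after $p$ with $\mathrm{horiz}_v(p')=\mathrm{horiz}_v(p)$, and let $D_{[p,p']}$ be the part of $u$ from $p$ to $p'$. Let $u'$ be obtained from $u$ by exchanging $E$ and $D_{[p,p']}$; then $u$ is related to $u'$. Let $\overleftarrow{v}$ be the path obtained from $v$ by reading its steps in reverse order and replacing north steps by east steps and vice versa. Theorem. For every path $v$, the poset $\mathrm{Tam}(v)$ is isomorphic to the order dual of $\mathrm{Tam}(\overleftarrow{v})$. -/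

import Mathlib

namespace VTamari

/-- A unit step on the square grid: north `N` or east `E`. -/
inductive Step where
  | N
  | E
  deriving DecidableEq

/-- A finite path on the square grid starting at the origin, given by its sequence of unit steps. -/
abbrev LatticePath := List Step

/-- The abscissa of the final point of a path. The integer points of a path are the final points
of its initial segments. -/
def endX (u : LatticePath) : ℕ := u.count Step.E

/-- The ordinate of the final point of a path. -/
def endY (u : LatticePath) : ℕ := u.count Step.N

/-- `eastmost v y` is the largest abscissa of a point of `v` at height `y`
(for `y` at most the height of `v`). -/
def eastmost : LatticePath → ℕ → ℕ
  | [], _ => 0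
  | Step.E :: v, y => eastmost v y + 1
  | Step.N :: _, 0 => 0
  | Step.N :: v, y + 1 => eastmost v y

/-- The horizontal distance to `v` of the final point `p` of the path `w`: the number of east steps
that can be added to the right of `p` without crossing `v`. It is nonnegative as soon as `p` is
weakly above (that is, weakly to the left of) `v`. -/
def horiz (v w : LatticePath) : ℤ := (eastmost v (endY w) : ℤ) - (endX w : ℤ)

/-- `u` ends at the end of `v` and is weakly above `v`: no point of `u` is strictly to the right
of all the points of `v` at the same height. -/
def WeaklyAbove (u v : LatticePath) : Prop :=
  endX u = endX v ∧ endY u = endY v ∧ ∀ w : LatticePath, w <+: u → endX w ≤ eastmost v (endY w)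

/-- The relation defining `Tam v`. Write `u = a E d b`, where the point `p` at the end of `a E` is
followed by a north step, and where the point `p'` at the end of `a E d` is the first point of `u`
strictly after `p` which has the same horizontal distance as `p`. Then `u' = a d E b`. -/
def Cover (v u u' : LatticePath) : Prop :=
  ∃ a d b : LatticePath,
    u = a ++ [Step.E] ++ d ++ b ∧
    u' = a ++ d ++ [Step.E] ++ b ∧
    d.head? = some Step.N ∧
    horiz v (a ++ [Step.E] ++ d) = horiz v (a ++ [Step.E]) ∧
    ∀ c : LatticePath, c <+: d → c ≠ [] → c ≠ d →
      horiz v (a ++ [Step.E] ++ c) ≠ horiz v (a ++ [Step.E])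

/-- The underlying set of `Tam v`: the paths weakly above `v`, with the same endpoints as `v`. -/
def Tam (v : LatticePath) : Type := {u : LatticePath // WeaklyAbove u v}

/-- The order of `Tam v`: the reflexive and transitive closure of the relation `Cover v`. -/
instance (v : LatticePath) : LE (Tam v) :=
  ⟨Relation.ReflTransGen fun s t => Cover v s.1 t.1⟩

/-- The sum over the north steps of a path of the number of later steps; it is used only to show
that the order of `Tam v` is antisymmetric. -/
def area : LatticePath → ℕ
  | [] => 0
  | Step.N :: w => w.length + area w
  | Step.E :: w => area w

theorem area_append (s t : LatticePath) :
    area (s ++ t) = area s + s.count Step.N * t.length + area t := by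
  induction s with
  | nil => simp [area]
  | cons x s ih => cases x <;> simp [area, ih] <;> ring

theorem area_lt_of_cover {v u u' : LatticePath} (h : Cover v u u') : area u < area u' := by
  obtain ⟨a, d, b, rfl, rfl, hd, -, -⟩ := h
  have hpos : 0 < d.count Step.N := by
    cases d with
    | nil => simp at hd
    | cons x d => simp at hd; subst hd; simp
  simp [area_append, area]
  nlinarith

theorem eq_or_area_lt_of_le {v : LatticePath} {s t : Tam v} (h : s ≤ t) :
    s = t ∨ area s.1 < area t.1 := by
  induction (show Relation.ReflTransGen (fun s t : Tam v => Cover v s.1 t.1) s t from h) with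
  | refl => exact Or.inl rfl
  | @tail b c _ hc ih =>
    have hlt : area b.1 < area c.1 := area_lt_of_cover hc
    rcases ih ‹_› with rfl | ih
    · exact Or.inr hlt
    · exact Or.inr (ih.trans hlt)

/-- The poset `Tam v`. -/
instance (v : LatticePath) : PartialOrder (Tam v) where
  le_refl _ := Relation.ReflTransGen.refl
  le_trans _ _ _ h h' := Relation.ReflTransGen.trans h h'
  le_antisymm s t h h' := by
    rcases eq_or_area_lt_of_le h with h1 | h1
    · exact h1
    · rcases eq_or_area_lt_of_le h' with h2 | h2
      · exact h2.symm
      · omega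

/-- Exchange north and east steps. -/
def Step.swap : Step → Step
  | Step.N => Step.E
  | Step.E => Step.N

/-- The path obtained from `v` by reading its steps in reverse order and exchanging north and east
steps. -/
def reverseSwap (v : LatticePath) : LatticePath := v.reverse.map Step.swap

end VTamari

namespace VTamari

open Step

/-! `Tam v` is a disguised poset of binary trees in which duality is reflection. A tree has a canopy
(the types of its inner leaves) and a path (its internal edges in postorder), and the trees with
canopy `v` correspond bijectively to the paths weakly above `v` (`path_canopy_injective`,
`exists_of_weaklyAbove`). Under this bijection the generating relation of `Tam v` is exactly right
rotation with nonempty middle subtree (`Rotate.cover`, `exists_rotate_of_cover`). Reflecting trees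
reverses rotations and turns the canopy `v` into `reverseSwap v`, which gives the anti-isomorphism.

Everything rests on the distance `horiz` from the path of a tree to its canopy. In `both L R` it
agrees along `L.path` with the distance for `L`, is zero at the end of `L.path`, exceeds the
distance for `R` by one along `R.path`, hence is positive there, and drops to zero at the final `E`.
So the last zero before the end recovers `L` and `R`, and the return from the end of `L.path` is the
whole of `N R.path E`. -/

/-! ### Horizontal distance and concatenation. -/

theorem endX_append (s t : LatticePath) : endX (s ++ t) = endX s + endX t :=
  List.count_append

theorem endY_append (s t : LatticePath) : endY (s ++ t) = endY s + endY t :=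
  List.count_append

@[simp] theorem endX_nil : endX [] = 0 := rfl
@[simp] theorem endY_nil : endY [] = 0 := rfl
@[simp] theorem endX_cons_E (s : LatticePath) : endX (E :: s) = endX s + 1 := by simp [endX]
@[simp] theorem endX_cons_N (s : LatticePath) : endX (N :: s) = endX s := by simp [endX]
@[simp] theorem endY_cons_E (s : LatticePath) : endY (E :: s) = endY s := by simp [endY]
@[simp] theorem endY_cons_N (s : LatticePath) : endY (N :: s) = endY s + 1 := by simp [endY]

theorem endY_le_of_prefix {s t : LatticePath} (h : s <+: t) : endY s ≤ endY t := by
  obtain ⟨r, rfl⟩ := h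
  simp [endY_append]

theorem eastmost_append_N (v x : LatticePath) {y : ℕ} (hy : y ≤ endY v) :
    eastmost (v ++ N :: x) y = eastmost v y := by
  induction v generalizing y with
  | nil =>
    obtain rfl : y = 0 := by simpa using hy
    rfl
  | cons s v ih =>
    cases s with
    | E => simpa [eastmost] using ih (by simpa using hy)
    | N =>
      cases y with
      | zero => rfl
      | succ y => simpa [eastmost] using ih (by simpa using hy)

theorem eastmost_append (w v : LatticePath) (y : ℕ) :
    eastmost (w ++ v) (endY w + y) = endX w + eastmost v y := by
  induction w with
  | nil => simp
  | cons s w ih =>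
    cases s with
    | E =>
      simp [eastmost, ih]
      omega
    | N =>
      have h : endY (N :: w) + y = (endY w + y) + 1 := by simp; omega
      rw [h]
      simp [eastmost, ih]

theorem eastmost_endY (v : LatticePath) : eastmost v (endY v) = endX v := by
  simpa [eastmost] using eastmost_append v [] 0

theorem eastmost_le_succ (v : LatticePath) (y : ℕ) : eastmost v y ≤ eastmost v (y + 1) := by
  induction v generalizing y with
  | nil => rfl
  | cons s v ih =>
    cases s with
    | E => simpa [eastmost] using ih y
    | N =>
      cases y with
      | zero => simp [eastmost]
      | succ y => simpa [eastmost] using ih y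

theorem exists_split_at_height (v : LatticePath) {y : ℕ} (hy : y < endY v) :
    ∃ v₁ v₂, v = v₁ ++ N :: v₂ ∧ endY v₁ = y ∧ endX v₁ = eastmost v y := by
  induction v generalizing y with
  | nil => simp at hy
  | cons s v ih =>
    cases s with
    | E =>
      obtain ⟨v₁, v₂, rfl, h₁, h₂⟩ := ih (by simpa using hy)
      exact ⟨E :: v₁, v₂, rfl, by simpa using h₁, by simp [eastmost, h₂]⟩
    | N =>
      cases y with
      | zero => exact ⟨[], v, rfl, rfl, rfl⟩
      | succ y =>
        obtain ⟨v₁, v₂, rfl, h₁, h₂⟩ := ih (by simpa using hy)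
        exact ⟨N :: v₁, v₂, rfl, by simpa using h₁, by simpa [eastmost] using h₂⟩

theorem eq_cons_E_of_eastmost_pos {v : LatticePath} (h : 0 < eastmost v 0) :
    ∃ v', v = E :: v' := by
  cases v with
  | nil => simp [eastmost] at h
  | cons s v => cases s with
    | E => exact ⟨v, rfl⟩
    | N => simp [eastmost] at h

theorem horiz_append_N (v x w : LatticePath) (h : endY w ≤ endY v) :
    horiz (v ++ N :: x) w = horiz v w := by
  simp [horiz, eastmost_append_N v x h]

theorem horiz_append (x v y w : LatticePath) (h : endY x = endY y) :
    horiz (x ++ v) (y ++ w) = horiz v w + (endX x - endX y) := by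
  simp only [horiz, endY_append, ← h, eastmost_append, endX_append]
  push_cast
  ring

theorem horiz_append_E (v w : LatticePath) : horiz v (w ++ [E]) = horiz v w - 1 := by
  simp [horiz, endY_append, endX_append]
  ring

theorem horiz_le_append_N (v w : LatticePath) : horiz v w ≤ horiz v (w ++ [N]) := by
  have := eastmost_le_succ v (endY w)
  simp [horiz, endY_append, endX_append]
  omega

namespace WeaklyAbove

variable {u v : LatticePath}

theorem horiz_nonneg (h : WeaklyAbove u v) {w : LatticePath} (hw : w <+: u) :
    0 ≤ horiz v w := by
  have := h.2.2 w hw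
  simp only [horiz]
  omega

theorem horiz_eq_zero (h : WeaklyAbove u v) : horiz v u = 0 := by
  simp [horiz, h.2.1, eastmost_endY, h.1]

end WeaklyAbove

theorem weaklyAbove_iff {u v : LatticePath} : WeaklyAbove u v ↔
    endX u = endX v ∧ endY u = endY v ∧ ∀ w, w <+: u → 0 ≤ horiz v w := by
  simp only [WeaklyAbove, horiz, sub_nonneg, Nat.cast_le]

theorem prefix_concat_cases {α : Type*} {w u : List α} {s : α} (h : w <+: u ++ [s]) :
    w <+: u ∨ w = u ++ [s] := by
  rcases List.prefix_concat_iff.1 h with h | h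
  · exact Or.inr h
  · exact Or.inl h

theorem prefix_append_cases {α : Type*} {w u t : List α} (h : w <+: u ++ t) :
    w <+: u ∨ ∃ c, w = u ++ c ∧ c <+: t := by
  rcases List.prefix_or_prefix_of_prefix h (List.prefix_append u t) with h' | ⟨c, rfl⟩
  · exact Or.inl h'
  · exact Or.inr ⟨c, rfl, (List.prefix_append_right_inj u).1 h⟩

/-! ### Binary trees, their canopies, paths and rotations. -/

/-- Nonempty binary trees, according to which children of the root are nonempty. -/
inductive BinTree where
  | one
  | left (L : BinTree)
  | right (R : BinTree)
  | both (L R : BinTree)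

namespace BinTree

/-- The types of the leaves of a tree from left to right, without the first and the last one:
`E` for a left leaf and `N` for a right leaf. -/
def canopy : BinTree → LatticePath
  | one => []
  | left L => canopy L ++ [N]
  | right R => E :: canopy R
  | both L R => canopy L ++ N :: E :: canopy R

/-- The types of the internal edges of a tree in postorder: `N` for a left edge and `E` for
a right edge. -/
def path : BinTree → LatticePath
  | one => []
  | left L => path L ++ [N]
  | right R => path R ++ [E]
  | both L R => path L ++ N :: (path R ++ [E])

/-- The reflection of a tree. -/
def mirror : BinTree → BinTree
  | one => one
  | left L => right (mirror L)
  | right R => left (mirror R)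
  | both L R => both (mirror R) (mirror L)

theorem mirror_mirror (T : BinTree) : T.mirror.mirror = T := by
  induction T <;> simp_all [mirror]

theorem canopy_mirror (T : BinTree) : T.mirror.canopy = reverseSwap T.canopy := by
  induction T <;> simp_all [mirror, canopy, reverseSwap, Step.swap]

/-- The right rotations which preserve the canopy: the middle subtree is nonempty. -/
inductive Rotate : BinTree → BinTree → Prop
  | left_right (B : BinTree) : Rotate (left (right B)) (right (left B))
  | left_both (A B : BinTree) : Rotate (left (both A B)) (both A (left B))
  | both_right (B C : BinTree) : Rotate (both (right B) C) (right (both B C))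
  | both_both (A B C : BinTree) : Rotate (both (both A B) C) (both A (both B C))
  | left {L L' : BinTree} : Rotate L L' → Rotate (left L) (left L')
  | right {R R' : BinTree} : Rotate R R' → Rotate (right R) (right R')
  | both_fst {L L' : BinTree} (R : BinTree) : Rotate L L' → Rotate (both L R) (both L' R)
  | both_snd (L : BinTree) {R R' : BinTree} : Rotate R R' → Rotate (both L R) (both L R')

theorem Rotate.mirror {T T' : BinTree} (h : Rotate T T') : Rotate T'.mirror T.mirror := by
  induction h <;> simp only [BinTree.mirror] <;> constructor <;> assumption

theorem Rotate.canopy_eq {T T' : BinTree} (h : Rotate T T') : T.canopy = T'.canopy := by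
  induction h <;> simp_all [canopy]

/-- Steps added to the canopy after that of a left subtree start with `N`, so they leave distances
along its path unchanged; the `E` before the canopy of a right subtree raises them by one, which
pays for the final `E` of the path. -/
theorem weaklyAbove (T : BinTree) : WeaklyAbove T.path T.canopy := by
  rw [weaklyAbove_iff]
  induction T with
  | one => simp [path, canopy, horiz, eastmost]
  | left L ih =>
    obtain ⟨hx, hy, h⟩ := ih
    have hX : endX (left L).path = endX (left L).canopy := by
      simp [path, canopy, endX_append, hx]
    have hY : endY (left L).path = endY (left L).canopy := by
      simp [path, canopy, endY_append, hy]
    refine ⟨hX, hY, fun w hw => ?_⟩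
    rcases prefix_concat_cases hw with hw | rfl
    · rw [canopy, horiz_append_N _ _ _ (hy ▸ endY_le_of_prefix hw)]
      exact h w hw
    · change 0 ≤ horiz (left L).canopy (left L).path
      simp [horiz, hX, hY, eastmost_endY]
  | right R ih =>
    obtain ⟨hx, hy, h⟩ := ih
    have hX : endX (right R).path = endX (right R).canopy := by
      simp [path, canopy, endX_append, hx]
    have hY : endY (right R).path = endY (right R).canopy := by
      simp [path, canopy, endY_append, hy]
    refine ⟨hX, hY, fun w hw => ?_⟩
    rcases prefix_concat_cases hw with hw | rfl
    · have hh : horiz (right R).canopy w = horiz R.canopy w + 1 := by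
        simpa [canopy] using horiz_append [E] R.canopy [] w rfl
      have := h w hw
      omega
    · change 0 ≤ horiz (right R).canopy (right R).path
      simp [horiz, hX, hY, eastmost_endY]
  | both L R ihL ihR =>
    obtain ⟨hx, hy, h⟩ := ihL
    obtain ⟨hx', hy', h'⟩ := ihR
    have hX : endX (both L R).path = endX (both L R).canopy := by
      simp [path, canopy, endX_append, hx, hx']
    have hY : endY (both L R).path = endY (both L R).canopy := by
      simp [path, canopy, endY_append, hy, hy']
    refine ⟨hX, hY, fun w hw => ?_⟩
    have hp : (both L R).path = ((L.path ++ [N]) ++ R.path) ++ [E] := by simp [path]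
    rw [hp] at hw
    rcases prefix_concat_cases hw with hw | rfl
    · rcases prefix_append_cases hw with hw | ⟨c, rfl, hc⟩
      · rcases prefix_concat_cases hw with hw | rfl
        · rw [canopy, horiz_append_N _ _ _ (hy ▸ endY_le_of_prefix hw)]
          exact h w hw
        · refine le_trans ?_ (horiz_le_append_N _ _)
          rw [canopy, horiz_append_N _ _ _ hy.le]
          exact h _ List.prefix_rfl
      · have hh : horiz (both L R).canopy (L.path ++ [N] ++ c) = horiz R.canopy c + 1 := by
          simpa [canopy, endX_append, hx] using
            horiz_append (L.canopy ++ [N, E]) R.canopy (L.path ++ [N]) c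
              (by simp [endY_append, hy])
        have := h' c hc
        omega
    · rw [← hp]
      simp [horiz, hX, hY, eastmost_endY]

/-! ### Distances along the path of a tree, and the bijection with paths above the canopy. -/

theorem endX_path (T : BinTree) : endX T.path = endX T.canopy := T.weaklyAbove.1
theorem endY_path (T : BinTree) : endY T.path = endY T.canopy := T.weaklyAbove.2.1

theorem length_path (T : BinTree) : T.path.length = T.canopy.length := by
  induction T <;> simp_all [path, canopy]

theorem horiz_left {L : BinTree} {w : LatticePath} (h : w <+: L.path) :
    horiz (left L).canopy w = horiz L.canopy w :=
  horiz_append_N _ _ _ (L.endY_path ▸ endY_le_of_prefix h)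

theorem horiz_right (R : BinTree) (w : LatticePath) :
    horiz (right R).canopy w = horiz R.canopy w + 1 := by
  simpa [canopy] using horiz_append [E] R.canopy [] w rfl

theorem horiz_both_fst {L : BinTree} (R : BinTree) {w : LatticePath} (h : w <+: L.path) :
    horiz (both L R).canopy w = horiz L.canopy w :=
  horiz_append_N _ _ _ (L.endY_path ▸ endY_le_of_prefix h)

theorem horiz_both_snd (L R : BinTree) (w : LatticePath) :
    horiz (both L R).canopy (L.path ++ N :: w) = horiz R.canopy w + 1 := by
  have := horiz_append (L.canopy ++ [N, E]) R.canopy (L.path ++ [N]) w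
    (by simp [endY_append, L.endY_path])
  simpa [canopy, endX_append, L.endX_path] using this

theorem horiz_path (T : BinTree) : horiz T.canopy T.path = 0 := T.weaklyAbove.horiz_eq_zero

theorem horiz_both_path_fst (L R : BinTree) : horiz (both L R).canopy L.path = 0 := by
  rw [horiz_both_fst R List.prefix_rfl, horiz_path]

theorem horiz_nonneg {T : BinTree} {w : LatticePath} (h : w <+: T.path) :
    0 ≤ horiz T.canopy w := T.weaklyAbove.horiz_nonneg h

theorem horiz_both_snd_pos (L : BinTree) {R : BinTree} {w : LatticePath} (h : w <+: R.path) :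
    0 < horiz (both L R).canopy (L.path ++ N :: w) := by
  have := horiz_nonneg h
  rw [horiz_both_snd]
  omega

/-- The part of the path of `both L R` after that of `L` stays strictly above the canopy. -/
theorem path_fst_eq_of_both {L R L' R' : BinTree} (hp : (both L R).path = (both L' R').path)
    (hc : (both L R).canopy = (both L' R').canopy) : L'.path <+: L.path := by
  have h : L'.path <+: (L.path ++ N :: R.path) ++ [E] := by
    refine ⟨N :: (R'.path ++ [E]), ?_⟩
    simpa [path] using hp.symm
  have h0 := horiz_both_path_fst L' R'
  rw [← hc] at h0
  rcases prefix_concat_cases h with h | h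
  · rcases prefix_append_cases h with h | ⟨c, hw, hc'⟩
    · exact h
    · cases c with
      | nil => simp [hw]
      | cons s c =>
        obtain ⟨rfl, hcR⟩ := List.cons_prefix_cons.1 hc'
        have := horiz_both_snd_pos L hcR
        rw [hw] at h0
        omega
  · have := congrArg List.length hp
    have := congrArg List.length h
    simp [path] at *
    omega

/-- A final `N` singles out `left`. After a final `E`, `both` differs from `right` by a point at
distance zero before the end; the last such point ends the path of the left subtree. -/
theorem path_canopy_injective {T T' : BinTree} (hp : T.path = T'.path)
    (hc : T.canopy = T'.canopy) : T = T' := by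
  have right_ne_both : ∀ {R L' R' : BinTree}, (right R).path = (both L' R').path →
      (right R).canopy = (both L' R').canopy → False := by
    intro R L' R' hp hc
    have h0 := horiz_both_path_fst L' R'
    rw [← hc, horiz_right] at h0
    have h : L'.path <+: R.path := by
      refine ⟨N :: R'.path, ?_⟩
      have : R.path ++ [E] = (L'.path ++ N :: R'.path) ++ [E] := by simpa [path] using hp
      exact (List.append_cancel_right this).symm
    have := horiz_nonneg h
    omega
  induction T generalizing T' with
  | one => cases T' <;> simp [path] at hp ⊢
  | left L ih =>
    cases T' with
    | one => simp [path] at hp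
    | left L' =>
      rw [ih (List.append_cancel_right hp) (List.append_cancel_right hc)]
    | right R' => simp [path] at hp
    | both L' R' =>
      have := congrArg List.getLast? hp
      simp [path, List.getLast?_append, List.getLast?_cons] at this
  | right R ih =>
    cases T' with
    | one => simp [path] at hp
    | left L' => simp [path] at hp
    | right R' =>
      rw [ih (List.append_cancel_right hp) (List.cons.inj hc).2]
    | both L' R' => exact (right_ne_both hp hc).elim
  | both L R ihL ihR =>
    cases T' with
    | one => simp [path] at hp
    | left L' =>
      have := congrArg List.getLast? hp
      simp [path, List.getLast?_append, List.getLast?_cons] at this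
    | right R' => exact (right_ne_both hp.symm hc.symm).elim
    | both L' R' =>
      have h₁ := path_fst_eq_of_both hp hc
      have h₂ := path_fst_eq_of_both hp.symm hc.symm
      have hL := h₁.eq_of_length_le h₂.length_le
      -- Path and canopy have equal lengths, so equal left paths cut both canopies at the same
      -- place.
      have hlen : L.canopy.length = L'.canopy.length := by
        rw [← length_path, ← length_path, hL]
      obtain ⟨hcL, hcR⟩ := List.append_inj hc hlen
      have hp' := (List.append_inj hp (congrArg List.length hL.symm)).2
      rw [ihL hL.symm hcL, ihR (List.append_cancel_right (List.cons.inj hp').2)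
        (List.cons.inj (List.cons.inj hcR).2).2]

/-- The root is read off from the last step of `u` and, when this is `E`, from the last earlier
point at distance zero, if any. -/
theorem exists_of_weaklyAbove (u v : LatticePath) (h : WeaklyAbove u v) :
    ∃ T : BinTree, T.path = u ∧ T.canopy = v := by
  induction hn : u.length using Nat.strong_induction_on generalizing u v with
  | _ n ih =>
  subst hn
  rcases List.eq_nil_or_concat' u with rfl | ⟨x, s, rfl⟩
  · refine ⟨one, rfl, ?_⟩
    obtain ⟨h₁, h₂, -⟩ := h
    cases v with
    | nil => rfl
    | cons s v => cases s <;> simp at h₁ h₂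
  have hend := h.horiz_eq_zero
  obtain ⟨hx, hy, -⟩ := id h
  have hnn : ∀ w, w <+: x ++ [s] → 0 ≤ horiz v w := fun w hw => h.horiz_nonneg hw
  cases s with
  | N =>
    -- The distance is nonnegative, does not decrease along `N`, and ends at zero.
    have hx0 : horiz v x = 0 := by
      have := horiz_le_append_N v x
      have := hnn x (List.prefix_append _ _)
      omega
    simp only [endX_append, endY_append, endX_cons_N, endY_cons_N, endX_nil, endY_nil] at hx hy
    obtain ⟨v₁, v₂, rfl, h₁, h₂⟩ := exists_split_at_height v (y := endY x) (by omega)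
    have hX : endX v₁ = endX x := by simp only [horiz] at hx0; omega
    simp only [endX_append, endY_append, endX_cons_N, endY_cons_N] at hx hy
    obtain rfl : v₂ = [] := by
      cases v₂ with
      | nil => rfl
      | cons s v => cases s <;> simp at hx hy; all_goals omega
    obtain ⟨L, rfl, rfl⟩ := ih x.length (by simp) x v₁ (weaklyAbove_iff.2
      ⟨hX.symm, h₁.symm, fun w hw => by
        rw [← horiz_append_N v₁ [] w (h₁ ▸ endY_le_of_prefix hw)]
        exact hnn w (hw.trans (List.prefix_append _ _))⟩) rfl
    exact ⟨left L, rfl, rfl⟩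
  | E =>
    by_cases hex : ∃ k, ∃ w z, x = w ++ z ∧ z.length = k ∧ horiz v w = 0
    · classical
      -- The shortest remainder `z` gives the last zero `w`. The next step is `N`: an `E` would make
      -- the distance negative, and just before the final `E` the distance is one.
      obtain ⟨w, z, rfl, hk, hw0⟩ := Nat.find_spec hex
      have hmin : ∀ w' z', w ++ z = w' ++ z' → horiz v w' = 0 → z.length ≤ z'.length :=
        fun w' z' hz hw' => hk ▸ Nat.find_min' hex ⟨w', z', hz, rfl, hw'⟩
      cases z with
      | nil =>
        rw [horiz_append_E] at hend
        simp only [List.append_nil] at hend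
        omega
      | cons s z =>
        cases s with
        | E =>
          have := hnn (w ++ [E]) ⟨z ++ [E], by simp⟩
          rw [horiz_append_E] at this
          omega
        | N =>
          have hpos : ∀ c, c <+: z → 0 < horiz v (w ++ N :: c) := by
            rintro c ⟨r, rfl⟩
            have h₁ := hnn (w ++ N :: c) ⟨r ++ [E], by simp⟩
            refine lt_of_le_of_ne h₁ fun h₀ => ?_
            have := hmin (w ++ N :: c) r (by simp) h₀.symm
            simp at this
          simp only [endX_append, endY_append, endX_cons_N, endY_cons_N, endX_nil, endY_nil,
            endX_cons_E, endY_cons_E] at hx hy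
          obtain ⟨v₁, v₂, rfl, h₁, h₂⟩ := exists_split_at_height v (y := endY w) (by omega)
          have hX : endX v₁ = endX w := by simp only [horiz] at hw0; omega
          have hshift : ∀ c, horiz (v₁ ++ N :: v₂) (w ++ N :: c) = horiz v₂ c := fun c => by
            simpa [endX_append, hX] using
              horiz_append (v₁ ++ [N]) v₂ (w ++ [N]) c (by simp [endY_append, h₁])
          -- The distance is still positive right after `w N`, so `v` continues east there.
          obtain ⟨v₃, rfl⟩ := eq_cons_E_of_eastmost_pos (v := v₂) (by
            have := hpos [] List.nil_prefix
            rw [hshift] at this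
            simpa [horiz] using this)
          simp only [endX_append, endY_append, endX_cons_N, endY_cons_N, endX_cons_E,
            endY_cons_E] at hx hy
          obtain ⟨L, rfl, rfl⟩ := ih w.length (by simp) w v₁ (weaklyAbove_iff.2
            ⟨hX.symm, h₁.symm, fun c hc => by
              rw [← horiz_append_N v₁ (E :: v₃) c (h₁ ▸ endY_le_of_prefix hc)]
              exact hnn c (hc.trans ⟨N :: z ++ [E], by simp⟩)⟩) rfl
          obtain ⟨R, rfl, rfl⟩ := ih z.length (by simp; omega) z v₃ (weaklyAbove_iff.2
            ⟨by omega, by omega, fun c hc => by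
              have h₃ := hpos c hc
              have h₄ : horiz (E :: v₃) c = horiz v₃ c + 1 := by
                simpa using horiz_append [E] v₃ [] c rfl
              rw [hshift] at h₃
              omega⟩) rfl
          exact ⟨both L R, by simp [path], rfl⟩
    · have hpos : ∀ c, c <+: x → 0 < horiz v c := by
        rintro c ⟨r, rfl⟩
        have h₁ := hnn c ⟨r ++ [E], by simp⟩
        exact lt_of_le_of_ne h₁ fun h₀ => hex ⟨_, c, r, rfl, rfl, h₀.symm⟩
      obtain ⟨v₃, rfl⟩ := eq_cons_E_of_eastmost_pos (v := v) (by
        simpa [horiz] using hpos [] List.nil_prefix)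
      simp [endX_append, endY_append] at hx hy
      obtain ⟨R, rfl, rfl⟩ := ih x.length (by simp) x v₃ (weaklyAbove_iff.2
        ⟨hx, hy, fun c hc => by
          have h₃ := hpos c hc
          have h₄ : horiz (E :: v₃) c = horiz v₃ c + 1 := by
            simpa using horiz_append [E] v₃ [] c rfl
          omega⟩) rfl
      exact ⟨right R, rfl, rfl⟩

end BinTree

/-! ### Covering relations are rotations. -/

/-- The word `d` starts with a north step, and after `w` it leads to the first later point with
the same horizontal distance to `v` as the final point of `w`. -/
def IsReturn (v w d : LatticePath) : Prop :=
  d.head? = some N ∧ horiz v (w ++ d) = horiz v w ∧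
    ∀ c : LatticePath, c <+: d → c ≠ [] → c ≠ d → horiz v (w ++ c) ≠ horiz v w

theorem cover_iff {v u u' : LatticePath} : Cover v u u' ↔ ∃ a d b,
    u = a ++ [E] ++ d ++ b ∧ u' = a ++ d ++ [E] ++ b ∧ IsReturn v (a ++ [E]) d :=
  Iff.rfl

/-- Returns only compare distances, so a constant shift is harmless: `k` is 0 for left subtrees and
1 for right ones. -/
theorem isReturn_congr {v v' w w' d : LatticePath} (k : ℤ)
    (h : ∀ c, c <+: d → horiz v' (w' ++ c) = horiz v (w ++ c) + k) :
    IsReturn v' w' d ↔ IsReturn v w d := by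
  have h0 := h [] List.nil_prefix
  simp only [List.append_nil] at h0
  refine and_congr_right fun _ => and_congr ?_ ?_
  · rw [h d List.prefix_rfl, h0, add_left_inj]
  · refine forall_congr' fun c => forall_congr' fun hc => ?_
    rw [h c hc, h0, Ne, Ne, Ne, Ne, add_left_inj]

/-- The first step `N` cannot lower the distance, and each `E` lowers it by only one, so it cannot
fall below its initial value without attaining it first. -/
theorem IsReturn.horiz_lt {v w d : LatticePath} (h : IsReturn v w d) {c : LatticePath}
    (hc : c <+: d) (hc0 : c ≠ []) (hcd : c ≠ d) : horiz v w < horiz v (w ++ c) := by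
  obtain ⟨hN, -, h⟩ := h
  induction c using List.reverseRecOn with
  | nil => exact absurd rfl hc0
  | append_singleton c s ih =>
    refine lt_of_le_of_ne ?_ (h _ hc hc0 hcd).symm
    rcases eq_or_ne c [] with rfl | hne
    · obtain ⟨r, rfl⟩ := hc
      obtain rfl : s = N := by simpa using hN
      exact horiz_le_append_N v w
    · have hc' : c <+: d := (List.prefix_append _ _).trans hc
      have := ih hc' hne (by
        rintro rfl
        have := hc.length_le
        simp at this)
      rw [← List.append_assoc]
      cases s with
      | E => rw [horiz_append_E]; omega
      | N => exact this.le.trans (horiz_le_append_N v _)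

namespace BinTree

theorem isReturn_left {L : BinTree} {w d : LatticePath} (h : w ++ d <+: L.path) :
    IsReturn (left L).canopy w d ↔ IsReturn L.canopy w d :=
  isReturn_congr 0 fun c hc => by
    rw [horiz_left (((List.prefix_append_right_inj w).2 hc).trans h), add_zero]

theorem isReturn_right (R : BinTree) (w d : LatticePath) :
    IsReturn (right R).canopy w d ↔ IsReturn R.canopy w d :=
  isReturn_congr 1 fun c _ => by rw [horiz_right]

theorem isReturn_both_fst {L : BinTree} (R : BinTree) {w d : LatticePath}
    (h : w ++ d <+: L.path) :
    IsReturn (both L R).canopy w d ↔ IsReturn L.canopy w d :=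
  isReturn_congr 0 fun c hc => by
    rw [horiz_both_fst R (((List.prefix_append_right_inj w).2 hc).trans h), add_zero]

theorem isReturn_both_snd (L R : BinTree) (w d : LatticePath) :
    IsReturn (both L R).canopy (L.path ++ N :: w) d ↔ IsReturn R.canopy w d :=
  isReturn_congr 1 fun c _ => by
    rw [List.append_assoc, List.cons_append, horiz_both_snd]

theorem isReturn_left_path (L : BinTree) : IsReturn (left L).canopy L.path [N] := by
  refine ⟨rfl, ?_, fun c hc h0 h1 => ?_⟩
  · rw [horiz_left List.prefix_rfl, horiz_path]
    exact (left L).horiz_path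
  · rcases prefix_concat_cases (u := []) hc with h | h
    · exact absurd (List.prefix_nil.1 h) h0
    · exact absurd h h1

theorem isReturn_both_path (L R : BinTree) :
    IsReturn (both L R).canopy L.path (N :: (R.path ++ [E])) := by
  refine ⟨rfl, ?_, fun c hc h0 h1 => ?_⟩
  · rw [horiz_both_path_fst]
    exact (both L R).horiz_path
  · rw [horiz_both_path_fst]
    cases c with
    | nil => exact absurd rfl h0
    | cons s c =>
      obtain ⟨rfl, hcR⟩ := List.cons_prefix_cons.1 hc
      rcases prefix_concat_cases hcR with hcR | rfl
      · exact (horiz_both_snd_pos L hcR).ne'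
      · exact absurd rfl h1

/-- For a rotation at the root, `p` ends the path of the left subtree, whose last step is `E`
because the middle subtree is nonempty, and `p'` is the end of the whole path. -/
theorem Rotate.cover {T T' : BinTree} (h : Rotate T T') : Cover T.canopy T.path T'.path := by
  simp only [cover_iff] at *
  induction h with
  | left_right B =>
    exact ⟨B.path, [N], [], by simp [path], by simp [path], isReturn_left_path (BinTree.right B)⟩
  | left_both A B =>
    refine ⟨A.path ++ N :: B.path, [N], [], by simp [path], by simp [path], ?_⟩
    simpa [path] using isReturn_left_path (both A B)
  | both_right B C =>
    exact ⟨B.path, N :: (C.path ++ [E]), [], by simp [path], by simp [path],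
      isReturn_both_path (BinTree.right B) C⟩
  | both_both A B C =>
    refine ⟨A.path ++ N :: B.path, N :: (C.path ++ [E]), [], by simp [path], by simp [path], ?_⟩
    simpa [path] using isReturn_both_path (both A B) C
  | left _ ih =>
    obtain ⟨a, d, b, h₁, h₂, h⟩ := ih
    exact ⟨a, d, b ++ [N], by simp [path, h₁], by simp [path, h₂],
      (isReturn_left ⟨b, h₁.symm⟩).2 h⟩
  | right _ ih =>
    obtain ⟨a, d, b, h₁, h₂, h⟩ := ih
    exact ⟨a, d, b ++ [E], by simp [path, h₁], by simp [path, h₂], (isReturn_right _ _ _).2 h⟩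
  | both_fst R _ ih =>
    obtain ⟨a, d, b, h₁, h₂, h⟩ := ih
    exact ⟨a, d, b ++ N :: (R.path ++ [E]), by simp [path, h₁], by simp [path, h₂],
      (isReturn_both_fst R ⟨b, h₁.symm⟩).2 h⟩
  | both_snd L _ ih =>
    obtain ⟨a, d, b, h₁, h₂, h⟩ := ih
    refine ⟨L.path ++ N :: a, d, b ++ [E], by simp [path, h₁], by simp [path, h₂], ?_⟩
    simpa using (isReturn_both_snd L _ _ _).2 h

theorem eq_right_or_both_of_path {T : BinTree} {a : LatticePath} (h : T.path = a ++ [E]) :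
    (∃ B, T = right B ∧ a = B.path) ∨ ∃ A B, T = both A B ∧ a = A.path ++ N :: B.path := by
  cases T with
  | one => simp [path] at h
  | left L => simp [path] at h
  | right R => exact Or.inl ⟨R, rfl, (List.append_cancel_right h).symm⟩
  | both L R =>
    refine Or.inr ⟨L, R, rfl, ?_⟩
    have : (L.path ++ N :: R.path) ++ [E] = a ++ [E] := by simpa [path] using h
    exact (List.append_cancel_right this).symm

/-- A return which starts inside the path of `T` and passes its final point starts there. -/
theorem eq_nil_of_isReturn {T : BinTree} {v w x d : LatticePath} (h : IsReturn v w d)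
    (hw : ∀ c, c <+: T.path → horiz v c = horiz T.canopy c) (hT : T.path = w ++ x)
    (hx : x <+: d) (hne : x ≠ d) : x = [] := by
  by_contra h0
  have h₁ := h.horiz_lt hx h0 hne
  rw [← hT, hw _ List.prefix_rfl, horiz_path, hw w ⟨x, hT.symm⟩] at h₁
  have := horiz_nonneg (T := T) (w := w) ⟨x, hT.symm⟩
  omega

/-- The distance to the canopy of `R` is nonnegative at the start of the return but `-1` after the
extra `E`, so the return ends before this step. -/
theorem exists_eq_append_E_of_isReturn {R : BinTree} {a d b : LatticePath}
    (hu : R.path ++ [E] = a ++ [E] ++ d ++ b) (h : IsReturn R.canopy (a ++ [E]) d) :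
    ∃ b', b = b' ++ [E] ∧ R.path = a ++ [E] ++ d ++ b' := by
  rcases List.eq_nil_or_concat' b with rfl | ⟨b', s, rfl⟩
  · exfalso
    obtain ⟨hN, he, -⟩ := h
    rcases List.eq_nil_or_concat' d with rfl | ⟨d', s, rfl⟩
    · simp at hN
    have h1 : R.path ++ [E] = (a ++ [E] ++ d') ++ [s] := by simpa using hu
    obtain ⟨h2, h3⟩ := List.append_inj' h1 rfl
    have h4 := horiz_nonneg (T := R) (w := a ++ [E]) ⟨d', h2.symm⟩
    obtain rfl : E = s := by simpa using h3
    rw [← List.append_assoc, horiz_append_E, ← h2, horiz_path] at he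
    omega
  · have h1 : R.path ++ [E] = (a ++ [E] ++ d ++ b') ++ [s] := by simpa using hu
    obtain ⟨h2, h3⟩ := List.append_inj' h1 rfl
    obtain rfl : E = s := by simpa using h3
    exact ⟨b', rfl, h2⟩

theorem exists_rotate_of_path_eq {L R : BinTree} {a d b : LatticePath}
    (hL : L.path = a ++ [E]) (hR : d ++ b = N :: (R.path ++ [E]))
    (h : IsReturn (both L R).canopy (a ++ [E]) d) :
    ∃ T', Rotate (both L R) T' ∧ T'.path = a ++ d ++ [E] ++ b := by
  -- A shorter `d` would be an earlier return from the end of `L.path`.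
  have hd : d = N :: (R.path ++ [E]) := by
    by_contra hne
    rw [← hL] at h
    refine (isReturn_both_path L R).2.2 d ⟨b, hR⟩ ?_ hne h.2.1
    rintro rfl
    exact absurd h.1 (by simp)
  subst hd
  obtain rfl : b = [] := by simpa using hR
  rcases eq_right_or_both_of_path hL with ⟨B, rfl, rfl⟩ | ⟨A, B, rfl, rfl⟩
  · exact ⟨_, .both_right B R, by simp [path]⟩
  · exact ⟨_, .both_both A B R, by simp [path]⟩

/-- If `p` ends the path of the left subtree, the rotation is at the root. Otherwise the whole
return stays in the path of one subtree, and induction applies. -/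
theorem exists_rotate_of_cover {T : BinTree} {u : LatticePath} (h : Cover T.canopy T.path u) :
    ∃ T', Rotate T T' ∧ T'.path = u := by
  induction T generalizing u with
  | one =>
    obtain ⟨a, d, b, hu, -⟩ := h
    simp [path] at hu
  | left L ih =>
    obtain ⟨a, d, b, hu, rfl, hr⟩ := cover_iff.1 h
    rcases List.eq_nil_or_concat' b with rfl | ⟨b', s, rfl⟩
    · rcases List.eq_nil_or_concat' d with rfl | ⟨d', s, rfl⟩
      · exact absurd hr.1 (by simp)
      have h1 : L.path ++ [N] = (a ++ [E] ++ d') ++ [s] := by simpa [path] using hu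
      obtain ⟨h2, h3⟩ := List.append_inj' h1 rfl
      obtain rfl : N = s := by simpa using h3
      obtain rfl := eq_nil_of_isReturn hr (fun c hc => horiz_left hc) h2
        (List.prefix_append _ _) (by simp)
      rcases eq_right_or_both_of_path (by simpa using h2) with
        ⟨B, rfl, rfl⟩ | ⟨A, B, rfl, rfl⟩
      · exact ⟨_, .left_right B, by simp [path]⟩
      · exact ⟨_, .left_both A B, by simp [path]⟩
    · have h1 : L.path ++ [N] = (a ++ [E] ++ d ++ b') ++ [s] := by simpa [path] using hu
      obtain ⟨h2, h3⟩ := List.append_inj' h1 rfl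
      obtain rfl : N = s := by simpa using h3
      obtain ⟨L', hL, hp⟩ := ih (cover_iff.2 ⟨a, d, b', h2, rfl,
        (isReturn_left ⟨b', h2.symm⟩).1 hr⟩)
      exact ⟨_, .left hL, by simp [path, hp]⟩
  | right R ih =>
    obtain ⟨a, d, b, hu, rfl, hr⟩ := cover_iff.1 h
    rw [isReturn_right] at hr
    obtain ⟨b', rfl, h2⟩ := exists_eq_append_E_of_isReturn hu hr
    obtain ⟨R', hR, hp⟩ := ih (cover_iff.2 ⟨a, d, b', h2, rfl, hr⟩)
    exact ⟨_, .right hR, by simp [path, hp]⟩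
  | both L R ihL ihR =>
    obtain ⟨a, d, b, hu, rfl, hr⟩ := cover_iff.1 h
    have hu' : L.path ++ N :: (R.path ++ [E]) = (a ++ [E]) ++ (d ++ b) := by
      simpa [path] using hu
    rcases List.append_eq_append_iff.1 hu' with ⟨x, hx, hx'⟩ | ⟨x, hx, hx'⟩
    · cases x with
      | nil => exact exists_rotate_of_path_eq (by simpa using hx.symm) hx'.symm hr
      | cons s x =>
        obtain ⟨rfl, hR⟩ := List.cons.inj hx'
        rcases List.eq_nil_or_concat' x with rfl | ⟨a', s, rfl⟩
        -- Here `p` would be the end of `L.path N`, but it is preceded by `E`.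
        · simpa using (List.append_inj' hx rfl).2
        have h1 : a ++ [E] = (L.path ++ N :: a') ++ [s] := by simpa using hx
        obtain ⟨rfl, h3⟩ := List.append_inj' h1 rfl
        obtain rfl : E = s := by simpa using h3
        rw [List.append_assoc, List.cons_append, isReturn_both_snd] at hr
        obtain ⟨b', rfl, h2⟩ := exists_eq_append_E_of_isReturn (by simpa using hR) hr
        obtain ⟨R', hR', hp⟩ := ihR (cover_iff.2 ⟨a', d, b', h2, rfl, hr⟩)
        exact ⟨_, .both_snd L hR', by simp [path, hp]⟩
    · have of_prefix : ∀ b', L.path = a ++ [E] ++ d ++ b' →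
          b = b' ++ N :: (R.path ++ [E]) →
          ∃ T', Rotate (both L R) T' ∧ T'.path = a ++ d ++ [E] ++ b := by
        rintro b' h2 rfl
        obtain ⟨L', hL, hp⟩ := ihL (cover_iff.2 ⟨a, d, b', h2, rfl,
          (isReturn_both_fst R ⟨b', h2.symm⟩).1 hr⟩)
        exact ⟨_, .both_fst R hL, by simp [path, hp]⟩
      -- Either the return ends within `L.path`, or it passes its end, and then it must start there.
      rcases List.append_eq_append_iff.1 hx' with ⟨y, rfl, hb⟩ | ⟨y, rfl, hb⟩
      · exact of_prefix y (by simpa using hx) hb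
      · rcases eq_or_ne y [] with rfl | hy
        · exact of_prefix [] (by simpa using hx) (by simpa using hb.symm)
        · obtain rfl := eq_nil_of_isReturn hr (fun c hc => horiz_both_fst R hc) hx
            (List.prefix_append _ _) (by simpa using hy)
          exact exists_rotate_of_path_eq (by simpa using hx) (by simpa using hb.symm) hr

end BinTree

/-! ### Duality by reflection of trees. -/

/-- Trees with canopy `v` are in bijection with the elements of `Tam v`. -/
noncomputable def treeEquivTam (v : LatticePath) : {T : BinTree // T.canopy = v} ≃ Tam v :=
  Equiv.ofBijective (fun T => ⟨T.1.path, by simpa only [T.2] using T.1.weaklyAbove⟩) <| by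
    refine ⟨fun S T h => ?_, fun u => ?_⟩
    · exact Subtype.ext (BinTree.path_canopy_injective (congrArg Subtype.val h)
        (S.2.trans T.2.symm))
    · obtain ⟨T, hp, hc⟩ := BinTree.exists_of_weaklyAbove u.1 v u.2
      exact ⟨⟨T, hc⟩, Subtype.ext hp⟩

theorem cover_treeEquivTam {v : LatticePath} (S T : {T : BinTree // T.canopy = v}) :
    Cover v (treeEquivTam v S).1 (treeEquivTam v T).1 ↔ BinTree.Rotate S.1 T.1 := by
  obtain ⟨S, rfl⟩ := S
  obtain ⟨T, hT⟩ := T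
  change Cover S.canopy S.path T.path ↔ BinTree.Rotate S T
  refine ⟨fun h => ?_, BinTree.Rotate.cover⟩
  obtain ⟨T', hR, hp⟩ := BinTree.exists_rotate_of_cover h
  -- The rotated tree has the path and the canopy of `T`, hence equals `T`.
  rwa [BinTree.path_canopy_injective hp.symm (hT.trans hR.canopy_eq)]

theorem reverseSwap_reverseSwap (v : LatticePath) : reverseSwap (reverseSwap v) = v := by
  have h : Step.swap ∘ Step.swap = id := by
    funext s
    cases s <;> rfl
  simp [reverseSwap, h]

/-- Reflection exchanges trees with canopy `v` and trees with canopy `reverseSwap v`. -/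
def mirrorEquiv (v : LatticePath) :
    {T : BinTree // T.canopy = v} ≃ {T : BinTree // T.canopy = reverseSwap v} where
  toFun T := ⟨T.1.mirror, by rw [BinTree.canopy_mirror, T.2]⟩
  invFun T := ⟨T.1.mirror, by rw [BinTree.canopy_mirror, T.2, reverseSwap_reverseSwap]⟩
  left_inv T := Subtype.ext T.1.mirror_mirror
  right_inv T := Subtype.ext T.1.mirror_mirror

theorem rotate_mirror_iff {S T : BinTree} :
    BinTree.Rotate T.mirror S.mirror ↔ BinTree.Rotate S T :=
  ⟨fun h => by simpa only [BinTree.mirror_mirror] using h.mirror, BinTree.Rotate.mirror⟩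

/-- The bijection between `Tam v` and `Tam (reverseSwap v)` given by the reflection of trees. -/
noncomputable def tamEquiv (v : LatticePath) : Tam v ≃ Tam (reverseSwap v) :=
  (treeEquivTam v).symm.trans ((mirrorEquiv v).trans (treeEquivTam (reverseSwap v)))

theorem cover_tamEquiv {v : LatticePath} (s t : Tam v) :
    Cover (reverseSwap v) (tamEquiv v t).1 (tamEquiv v s).1 ↔ Cover v s.1 t.1 := by
  obtain ⟨S, rfl⟩ := (treeEquivTam v).surjective s
  obtain ⟨T, rfl⟩ := (treeEquivTam v).surjective t
  simp only [tamEquiv, Equiv.trans_apply, Equiv.symm_apply_apply, cover_treeEquivTam]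
  exact rotate_mirror_iff

theorem tamEquiv_le_iff {v : LatticePath} (s t : Tam v) :
    tamEquiv v t ≤ tamEquiv v s ↔ s ≤ t := by
  constructor
  · intro h
    have key : ∀ x y : Tam (reverseSwap v), x ≤ y →
        (tamEquiv v).symm y ≤ (tamEquiv v).symm x := by
      intro x y h
      refine Relation.ReflTransGen.swap _ _ (Relation.ReflTransGen.lift (tamEquiv v).symm ?_ _ _ h)
      intro x y hxy
      rw [← Equiv.apply_symm_apply (tamEquiv v) x, ← Equiv.apply_symm_apply (tamEquiv v) y] at hxy
      exact (cover_tamEquiv _ _).1 hxy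
    simpa using key _ _ h
  · intro h
    exact Relation.ReflTransGen.swap _ _ (Relation.ReflTransGen.lift (tamEquiv v)
      (fun x y hxy => (cover_tamEquiv x y).2 hxy) _ _ h)

end VTamari

theorem theorem2 (v : VTamari.LatticePath) :
    Nonempty (VTamari.Tam v ≃o (VTamari.Tam (VTamari.reverseSwap v))ᵒᵈ) :=
  ⟨{ toEquiv := (VTamari.tamEquiv v).trans OrderDual.toDual
     map_rel_iff' := fun {s t} => VTamari.tamEquiv_le_iff s t }⟩
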